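/- All graphs are finite and simple. For positive integers $n,\ell$ let $H_{n,\ell}$ be the binary Hamming graph: its vertex set is $\mathbb F_2^n$, and $x,y$ are adjacent if and only if they differ in exactly $\ell$ coordinates. The product $\Gamma_1\times\Gamma_2$ of two graphs has vertex set $V(\Gamma_1)\times V(\Gamma_2)$, with $(x_1,x_2)$ adjacent to $(y_1,y_2)$ if and only if $x_1$ is adjacent to $y_1$ in $\Gamma_1$ and $x_2$ is adjacent to $y_2$ in $\Gamma_2$. A quantum homomorphism from $\Gamma_1$ to $\Gamma_2$ consists of an integer $d\ge 1$ and matrices $P_{x,y}\in\mathbb C^{d\times d}$ for $x\in V(\Gamma_1)$, $y\in V(\Gamma_2)$ such that (i) $P_{x,y}^2=P_{x,y}=P_{x,y}^*$ for all $x,y$; (ii) for every $x$, $P_{x,y}P_{x,y'}=0$ whenever $y\ne y'$, and $\sum_{y}P_{x,y}=I_d$; (iii) $P_{x,y}P_{x',y'}=0$ whenever $x,x'$ are adjacent in $\Gamma_1$ and $y,y'$ are not adjacent in $\Gamma_2$ (in particular when $y=y'$). The quantum chromatic number $\chi_q(\Gamma)$ is the least $c$ for which there is a quantum homomorphism from $\Gamma$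 to the complete graph $K_c$. **Theorem.** Let $s\ge t$ be positive integers. Then 1. $\chi_q(H_{4t,2t}\times H_{4s,2s})=4t$; 2. $\chi_q(H_{4t-1,2t}\times H_{4s,2s})=4t$; 3. $\chi_q(H_{4t,2t}\times H_{4s-1,2s})=4t$; 4. $\chi_q(H_{4t-1,2t}\times H_{4s-1,2s})=4t$. -/

import Mathlib

namespace QuantumColoring

/-- The binary Hamming graph `H_{n,l}`: the vertices are the vectors of `𝔽₂ⁿ`, and two (distinct)
vectors are adjacent when their Hamming distance is exactly `l`. -/
def hammingGraph (n l : ℕ) : SimpleGraph (Fin n → ZMod 2) where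
  Adj x y := x ≠ y ∧ hammingDist x y = l
  symm := ⟨fun x y h => ⟨h.1.symm, by rw [hammingDist_comm]; exact h.2⟩⟩
  loopless := ⟨fun _ h => h.1 rfl⟩

/-- The (categorical, also called tensor) product of two graphs: `(x₁, x₂)` is adjacent to
`(y₁, y₂)` when `x₁` is adjacent to `y₁` and `x₂` is adjacent to `y₂`. -/
def graphProduct {V W : Type*} (G : SimpleGraph V) (H : SimpleGraph W) :
    SimpleGraph (V × W) where
  Adj x y := G.Adj x.1 y.1 ∧ H.Adj x.2 y.2
  symm := ⟨fun _ _ h => ⟨h.1.symm, h.2.symm⟩⟩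
  loopless := ⟨fun x h => G.loopless.irrefl x.1 h.1⟩

/-- The `d × d` complex matrices `P x y` form a quantum homomorphism from `G` to `H`. -/
structure IsQuantumHom {V W : Type*} [Fintype W] (G : SimpleGraph V) (H : SimpleGraph W)
    {d : ℕ} (P : V → W → Matrix (Fin d) (Fin d) ℂ) : Prop where
  /-- Every `P x y` is an orthogonal projection: `P x y ^ 2 = P x y = (P x y)ᴴ`. -/
  idem : ∀ x y, P x y * P x y = P x y
  selfAdj : ∀ x y, (P x y).conjTranspose = P x y
  /-- For fixed `x`, the projections are mutually orthogonal and sum to the identity. -/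
  orthogonal : ∀ x y y', y ≠ y' → P x y * P x y' = 0
  complete : ∀ x, ∑ y, P x y = 1
  /-- Adjacent vertices of `G` and non-adjacent (possibly equal) vertices of `H` give
  orthogonal projections. -/
  edge : ∀ x x' y y', G.Adj x x' → ¬ H.Adj y y' → P x y * P x' y' = 0

/-- There is a quantum homomorphism from `G` to `H`, in some positive dimension `d`. -/
def HasQuantumHom {V W : Type*} [Fintype W] (G : SimpleGraph V) (H : SimpleGraph W) : Prop :=
  ∃ d : ℕ, 0 < d ∧ ∃ P : V → W → Matrix (Fin d) (Fin d) ℂ, IsQuantumHom G H P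

/-- The quantum chromatic number of `G`: the least `c` such that there is a quantum homomorphism
from `G` to the complete graph on `c` vertices (and `⊤` if there is no such `c`). -/
noncomputable def quantumChromaticNumber {V : Type*} (G : SimpleGraph V) : ℕ∞ :=
  ⨅ c ∈ {c : ℕ | HasQuantumHom G (⊤ : SimpleGraph (Fin c))}, (c : ℕ∞)

end QuantumColoring

namespace QuantumColoring

open Finset Matrix

/-! ### Functoriality -/

/-! Prepending a zero maps `H_{4r-1,2r}` into `H_{4r,2r}`. Hence all four products map to
`H_{4t,2t}` through the first factor, and all receive `H_{4t-1,2t} × H_{4s-1,2s}`. It suffices to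
colour the former with `4t` colours and to bound the latter from below.

Upper bound (`hammingGraph_hasQuantumHom`): twist the Fourier basis of `ℂ^{4t}` by the sign vector
of `x` and take rank-one projections. Sign vectors at Hamming distance `2t` are orthogonal, so
adjacent vertices never share a colour.

Lower bound (`HasQuantumHom.hoffman`): Hoffman's ratio bound survives for projections, because
positive semidefinite matrices can be paired with Hilbert–Schmidt Gram matrices. Characters
diagonalise the Hamming graphs. With `m = 2t - 1`, self-duality turns the eigenvalues of
`H_{2m+1,m+1}` into coefficients of `(1 - X)(1 - X²)^m`, and a binomial inequality shows each is at
least `-1/(2m+1)` times the degree. Eigenvalues of a product graph are products, and `t ≤ s` makes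
the first factor the binding one, giving `1 + (2m+1) = 4t`. -/

theorem HasQuantumHom.comp {V V' W : Type*} [Fintype W] {G : SimpleGraph V} {G' : SimpleGraph V'}
    {H : SimpleGraph W} (f : G' →g G) (h : HasQuantumHom G H) : HasQuantumHom G' H := by
  obtain ⟨d, hd, P, hP⟩ := h
  exact ⟨d, hd, fun x => P (f x), fun x => hP.idem (f x), fun x => hP.selfAdj (f x),
    fun x => hP.orthogonal (f x), fun x => hP.complete (f x),
    fun x x' y y' hx hy => hP.edge (f x) (f x') y y' (f.map_adj hx) hy⟩

theorem quantumChromaticNumber_eq {V : Type*} {G : SimpleGraph V} {n : ℕ}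
    (h : HasQuantumHom G (⊤ : SimpleGraph (Fin n)))
    (h' : ∀ c, HasQuantumHom G (⊤ : SimpleGraph (Fin c)) → n ≤ c) :
    quantumChromaticNumber G = (n : ℕ∞) :=
  le_antisymm (iInf₂_le (f := fun c (_ : c ∈ {c : ℕ | HasQuantumHom G (⊤ : SimpleGraph (Fin c))}) =>
    (c : ℕ∞)) n h) (le_iInf₂ fun c hc => by exact_mod_cast h' c hc)

/-- The product of graphs is functorial. -/
def graphProductMap {V W V' W' : Type*} {G : SimpleGraph V} {H : SimpleGraph W}
    {G' : SimpleGraph V'} {H' : SimpleGraph W'} (f : G →g G') (g : H →g H') :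
    graphProduct G H →g graphProduct G' H' where
  toFun x := (f x.1, g x.2)
  map_rel' h := ⟨f.map_adj h.1, g.map_adj h.2⟩

/-- The first projection of a product of graphs. -/
def graphProductFst {V W : Type*} (G : SimpleGraph V) (H : SimpleGraph W) :
    graphProduct G H →g G where
  toFun x := x.1
  map_rel' h := h.1

/-- Prepending a zero embeds `H_{n,l}` into `H_{n+1,l}`. -/
def hammingGraphSucc (n l : ℕ) : hammingGraph n l →g hammingGraph (n + 1) l where
  toFun x := Fin.cons 0 x
  map_rel' {x y} h := by
    refine ⟨fun e => h.1 (Fin.cons_right_injective _ e), ?_⟩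
    rw [← h.2]
    simp only [hammingDist, Finset.card_filter, Fin.sum_univ_succ, Fin.cons_zero, Fin.cons_succ]
    simp

/-! ### The Hoffman bound for quantum colourings -/

/-- The real part of the Hilbert–Schmidt inner product. -/
noncomputable def hsInner {d : ℕ} (X Y : Matrix (Fin d) (Fin d) ℂ) : ℝ :=
  (∑ i, ∑ j, star (X i j) * Y i j).re

theorem hsInner_eq_trace {d : ℕ} (X Y : Matrix (Fin d) (Fin d) ℂ) :
    hsInner X Y = (trace (Xᴴ * Y)).re := by
  rw [hsInner, Finset.sum_comm]
  simp [trace, Matrix.mul_apply]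

theorem hsInner_self {d : ℕ} (X : Matrix (Fin d) (Fin d) ℂ) :
    hsInner X X = ∑ i, ∑ j, Complex.normSq (X i j) := by
  simp [hsInner, Complex.normSq_apply]

theorem hsInner_self_nonneg {d : ℕ} (X : Matrix (Fin d) (Fin d) ℂ) : 0 ≤ hsInner X X := by
  rw [hsInner_self]
  exact sum_nonneg fun _ _ => sum_nonneg fun _ _ => Complex.normSq_nonneg _

theorem sum_re_diag_sq_le_hsInner_self {d : ℕ} (X : Matrix (Fin d) (Fin d) ℂ) :
    ∑ i, (X i i).re ^ 2 ≤ hsInner X X := by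
  rw [hsInner_self]
  refine sum_le_sum fun i _ => le_trans ?_ (single_le_sum
    (f := fun j => Complex.normSq (X i j)) (fun _ _ => Complex.normSq_nonneg _) (mem_univ i))
  rw [Complex.normSq_apply]
  nlinarith [mul_self_nonneg (X i i).im]

theorem hsInner_sum_smul {d : ℕ} {V : Type*} [Fintype V] (e : V → ℝ)
    (X : V → Matrix (Fin d) (Fin d) ℂ) :
    hsInner (∑ v, e v • X v) (∑ v, e v • X v) = ∑ v, ∑ w, e v * e w * hsInner (X v) (X w) := by
  simp only [hsInner_eq_trace, conjTranspose_sum, Matrix.sum_mul, trace_sum,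
    Complex.re_sum, conjTranspose_smul, Matrix.smul_mul, Matrix.mul_smul, trace_smul,
    Complex.real_smul, Complex.re_ofReal_mul, star_trivial, mul_sum]
  rw [sum_comm]
  exact sum_congr rfl fun v _ => sum_congr rfl fun w _ => by ring

/-- The Hoffman bound: a positive semidefinite matrix `∑ μ a • e a ⊗ e a` with constant diagonal
`τ - δ` and entries `-δ` at distinct non-adjacent pairs bounds the size of quantum colourings. -/
theorem HasQuantumHom.hoffman {V ι : Type*} [Fintype V] [Fintype ι] [Nonempty V]
    {G : SimpleGraph V} {c : ℕ} (h : HasQuantumHom G (⊤ : SimpleGraph (Fin c)))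
    (e : ι → V → ℝ) (μ : ι → ℝ) (hμ : ∀ a, 0 ≤ μ a) {τ δ : ℝ} (hδ : 0 ≤ δ)
    (hdiag : ∀ v, ∑ a, μ a * (e a v * e a v) = τ - δ)
    (hoff : ∀ v w, v ≠ w → ¬ G.Adj v w → ∑ a, μ a * (e a v * e a w) = -δ) :
    δ * Fintype.card V ≤ τ * c := by
  classical
  obtain ⟨d, hd, P, hP⟩ := h
  have hadj : ∀ i v w, G.Adj v w → hsInner (P v i) (P w i) = 0 := fun i v w hvw => by
    rw [hsInner_eq_trace, hP.selfAdj, hP.edge v w i i hvw (by simp)]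
    simp
  -- Pair the positive semidefinite matrix with the Gram matrix of the `P v i`, whose entries vanish
  -- on edges; only the prescribed entries survive.
  have key : ∀ i, δ * hsInner (∑ v, P v i) (∑ v, P v i) ≤ τ * ∑ v, hsInner (P v i) (P v i) := by
    intro i
    have h0 : 0 ≤ ∑ a, μ a * hsInner (∑ v, e a v • P v i) (∑ v, e a v • P v i) :=
      sum_nonneg fun a _ => mul_nonneg (hμ a) (hsInner_self_nonneg _)
    have h1 : ∑ a, μ a * hsInner (∑ v, e a v • P v i) (∑ v, e a v • P v i)
        = ∑ v, ∑ w, (∑ a, μ a * (e a v * e a w)) * hsInner (P v i) (P w i) := by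
      simp only [hsInner_sum_smul, mul_sum, sum_mul]
      rw [sum_comm]
      refine sum_congr rfl fun v _ => ?_
      rw [sum_comm]
      exact sum_congr rfl fun w _ => sum_congr rfl fun a _ => by ring
    have h2 : ∀ v w, (∑ a, μ a * (e a v * e a w)) * hsInner (P v i) (P w i)
        = (if v = w then τ * hsInner (P v i) (P v i) else 0) - δ * hsInner (P v i) (P w i) := by
      intro v w
      rcases eq_or_ne v w with rfl | hvw
      · rw [hdiag, if_pos rfl]; ring
      · rw [if_neg hvw]
        by_cases ha : G.Adj v w
        · simp [hadj i v w ha]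
        · rw [hoff v w hvw ha]; ring
    have h3 := hsInner_sum_smul (fun _ => 1) (fun v => P v i)
    simp only [one_smul, one_mul] at h3
    rw [h1] at h0
    simp only [h2, sum_sub_distrib, sum_ite_eq, mem_univ, if_true] at h0
    rw [h3]
    simp only [mul_sum]
    linarith
  have htot : ∑ i, ∑ v, hsInner (P v i) (P v i) = Fintype.card V * d := by
    rw [sum_comm]
    have : ∀ v, ∑ i, hsInner (P v i) (P v i) = d := fun v => by
      simp only [hsInner_eq_trace, hP.selfAdj, hP.idem]
      rw [← Complex.re_sum, ← trace_sum, hP.complete]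
      simp
    simp [this]
  -- Summed over colours, the operators `∑ v, P v i` give `|V|` times the identity; Cauchy–Schwarz
  -- applies to each diagonal entry.
  have hlow : (Fintype.card V : ℝ) ^ 2 * d
      ≤ c * ∑ i, hsInner (∑ v, P v i) (∑ v, P v i) := by
    have hk : ∀ k : Fin d, (Fintype.card V : ℝ) ^ 2
        ≤ c * ∑ i : Fin c, (((∑ v, P v i) k k).re) ^ 2 := fun k => by
      have h4 : ∑ i : Fin c, ((∑ v, P v i) k k).re = Fintype.card V := by
        rw [← Complex.re_sum, ← Matrix.sum_apply, sum_comm]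
        simp [hP.complete, Matrix.sum_apply]
      have := sq_sum_le_card_mul_sum_sq (s := (univ : Finset (Fin c)))
        (f := fun i => ((∑ v, P v i) k k).re)
      rw [h4] at this
      simpa using this
    calc (Fintype.card V : ℝ) ^ 2 * d = ∑ _k : Fin d, (Fintype.card V : ℝ) ^ 2 := by
          simp [mul_comm]
      _ ≤ ∑ k : Fin d, c * ∑ i : Fin c, (((∑ v, P v i) k k).re) ^ 2 := sum_le_sum fun k _ => hk k
      _ = c * ∑ i : Fin c, ∑ k : Fin d, (((∑ v, P v i) k k).re) ^ 2 := by
          rw [← mul_sum, sum_comm]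
      _ ≤ _ := mul_le_mul_of_nonneg_left
          (sum_le_sum fun i _ => sum_re_diag_sq_le_hsInner_self _) (Nat.cast_nonneg _)
  have hsum := sum_le_sum fun i (_ : i ∈ (univ : Finset (Fin c))) => key i
  rw [← mul_sum, ← mul_sum, htot] at hsum
  have hpos : (0 : ℝ) < Fintype.card V * d := by
    have := Fintype.card_pos (α := V)
    positivity
  refine le_of_mul_le_mul_right ?_ hpos
  calc δ * Fintype.card V * (Fintype.card V * d) = δ * ((Fintype.card V : ℝ) ^ 2 * d) := by ring
    _ ≤ δ * (c * ∑ i, hsInner (∑ v, P v i) (∑ v, P v i)) := mul_le_mul_of_nonneg_left hlow hδ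
    _ = c * (δ * ∑ i, hsInner (∑ v, P v i) (∑ v, P v i)) := by ring
    _ ≤ c * (τ * (Fintype.card V * d)) := mul_le_mul_of_nonneg_left hsum (Nat.cast_nonneg _)
    _ = τ * c * (Fintype.card V * d) := by ring

/-! ### Characters of `𝔽₂ⁿ` -/

/-- The real character `x ↦ (-1) ^ x` of `𝔽₂`. -/
def signChar (x : ZMod 2) : ℝ := if x = 0 then 1 else -1

theorem signChar_zero : signChar 0 = 1 := if_pos rfl

theorem signChar_add (x y : ZMod 2) : signChar (x + y) = signChar x * signChar y := by
  have h : x + y = 0 ↔ (x = 0 ↔ y = 0) := by revert x y; decide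
  by_cases hx : x = 0 <;> by_cases hy : y = 0 <;> simp [signChar, h, hx, hy]

theorem signChar_mul_self (x : ZMod 2) : signChar x * signChar x = 1 := by
  unfold signChar; split_ifs <;> norm_num

theorem signChar_mul (x y : ZMod 2) : signChar x * signChar y = if x = y then 1 else -1 := by
  rw [← signChar_add, signChar]
  simp only [add_eq_zero_iff_eq_neg, CharTwo.neg_eq]

theorem abs_signChar (x : ZMod 2) : |signChar x| = 1 := by
  unfold signChar; split_ifs <;> norm_num

/-- The characters of `𝔽₂ⁿ`. -/
def cubeChar {n : ℕ} (a v : Fin n → ZMod 2) : ℝ := ∏ i, signChar (a i * v i)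

theorem cubeChar_comm {n : ℕ} (a v : Fin n → ZMod 2) : cubeChar a v = cubeChar v a := by
  simp [cubeChar, mul_comm]

theorem cubeChar_zero_left {n : ℕ} (v : Fin n → ZMod 2) : cubeChar 0 v = 1 := by
  simp [cubeChar, signChar_zero]

theorem cubeChar_add {n : ℕ} (a v w : Fin n → ZMod 2) :
    cubeChar a (v + w) = cubeChar a v * cubeChar a w := by
  simp [cubeChar, mul_add, signChar_add, prod_mul_distrib]

theorem abs_cubeChar {n : ℕ} (a v : Fin n → ZMod 2) : |cubeChar a v| = 1 := by
  simp [cubeChar, abs_prod, abs_signChar]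

theorem cube_neg_eq {n : ℕ} (v : Fin n → ZMod 2) : -v = v :=
  funext fun _ => CharTwo.neg_eq _

theorem sum_cubeChar {n : ℕ} (v : Fin n → ZMod 2) :
    ∑ a, cubeChar a v = if v = 0 then 2 ^ n else 0 := by
  have h1 : ∑ a, cubeChar a v = ∏ i, ∑ b : ZMod 2, signChar (b * v i) := by
    rw [Finset.prod_univ_sum, Fintype.piFinset_univ]; rfl
  have h2 : ∀ x : ZMod 2, ∑ b : ZMod 2, signChar (b * x) = if x = 0 then 2 else 0 := by
    intro x
    rw [show (univ : Finset (ZMod 2)) = {0, 1} from rfl, sum_pair (by decide)]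
    simp only [zero_mul, one_mul, signChar]
    split_ifs <;> norm_num
  simp only [h1, h2]
  split_ifs with hv
  · simp [hv]
  · obtain ⟨i, hi⟩ := Function.ne_iff.mp hv
    exact prod_eq_zero (mem_univ i) (if_neg hi)

/-- The eigenvalue of `H_{n,l}` at the character `a`. -/
def cubeEigenvalue {n : ℕ} (l : ℕ) (a : Fin n → ZMod 2) : ℝ :=
  ∑ v with hammingNorm v = l, cubeChar a v

theorem cubeEigenvalue_zero {n : ℕ} (l : ℕ) :
    cubeEigenvalue l (0 : Fin n → ZMod 2) = #{v : Fin n → ZMod 2 | hammingNorm v = l} := by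
  simp [cubeEigenvalue, cubeChar_zero_left]

theorem abs_cubeEigenvalue_le {n : ℕ} (l : ℕ) (a : Fin n → ZMod 2) :
    |cubeEigenvalue l a| ≤ cubeEigenvalue l (0 : Fin n → ZMod 2) := by
  rw [cubeEigenvalue_zero]
  refine (abs_sum_le_sum_abs _ _).trans ?_
  simp [abs_cubeChar]

/-- Spectral decomposition of the adjacency matrix, scaled by `2 ^ n` since the characters are not
normalised. -/
theorem sum_cubeEigenvalue_mul {n : ℕ} (l : ℕ) (v w : Fin n → ZMod 2) :
    ∑ a, cubeEigenvalue l a * (cubeChar a v * cubeChar a w)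
      = if hammingDist v w = l then 2 ^ n else 0 := by
  have h1 : ∀ u : Fin n → ZMod 2, u + (v + w) = 0 ↔ u = -v + w := fun u => by
    rw [add_eq_zero_iff_eq_neg, cube_neg_eq, cube_neg_eq]
  simp only [cubeEigenvalue, sum_mul, ← cubeChar_add]
  rw [sum_comm]
  simp only [sum_cubeChar, h1, sum_ite_eq', mem_filter, mem_univ, true_and,
    hammingDist_eq_hammingNorm]

/-- Krawtchouk generating function. -/
theorem cubeEigenvalue_eq_coeff {n : ℕ} (l : ℕ) (a : Fin n → ZMod 2) :
    cubeEigenvalue l a = (((1 - Polynomial.X) ^ hammingNorm a *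
      (1 + Polynomial.X) ^ (n - hammingNorm a) : Polynomial ℝ)).coeff l := by
  open Polynomial in
  have h1 : ∏ i, ∑ b : ZMod 2, (C (signChar (a i * b)) * X ^ (if b = 0 then 0 else 1) : ℝ[X])
      = ∑ v : Fin n → ZMod 2, C (cubeChar a v) * X ^ hammingNorm v := by
    rw [Finset.prod_univ_sum, Fintype.piFinset_univ]
    refine sum_congr rfl fun v _ => ?_
    rw [prod_mul_distrib, prod_pow_eq_pow_sum, cubeChar, map_prod]
    simp [hammingNorm, card_filter]
  have h2 : ∀ i, ∑ b : ZMod 2, (C (signChar (a i * b)) * X ^ (if b = 0 then 0 else 1) : ℝ[X])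
      = if a i ≠ 0 then 1 - X else 1 + X := by
    intro i
    rw [show (univ : Finset (ZMod 2)) = {0, 1} from rfl, sum_pair (by decide)]
    by_cases h : a i = 0
    · simp [h, signChar]
    · simp [h, signChar, sub_eq_add_neg]
  simp only [h2, prod_ite, prod_const] at h1
  have h3 : #{i | ¬ a i ≠ 0} = n - hammingNorm a := by
    have := card_filter_add_card_filter_not (s := (univ : Finset (Fin n))) (fun i => a i ≠ 0)
    simp only [card_univ, Fintype.card_fin] at this
    rw [hammingNorm]
    omega
  rw [h3] at h1
  change (1 - X) ^ hammingNorm a * _ = _ at h1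
  rw [h1, finsetSum_coeff]
  simp [cubeEigenvalue, coeff_X_pow, sum_filter, eq_comm]

theorem card_hammingNorm_eq (n l : ℕ) :
    #{v : Fin n → ZMod 2 | hammingNorm v = l} = n.choose l := by
  have h := cubeEigenvalue_eq_coeff l (0 : Fin n → ZMod 2)
  rw [cubeEigenvalue_zero] at h
  simp only [hammingNorm_zero, pow_zero, one_mul, Nat.sub_zero,
    Polynomial.coeff_one_add_X_pow] at h
  exact_mod_cast h

/-- Self-duality of the Krawtchouk polynomials. -/
theorem choose_mul_cubeEigenvalue {n : ℕ} (l : ℕ) (a : Fin n → ZMod 2) :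
    (n.choose (hammingNorm a) : ℝ) * cubeEigenvalue l a
      = n.choose l * (((1 - Polynomial.X) ^ l *
        (1 + Polynomial.X) ^ (n - l) : Polynomial ℝ)).coeff (hammingNorm a) := by
  -- Sum `cubeChar b v` over `b` of weight `hammingNorm a` and `v` of weight `l`, in both orders;
  -- each inner sum depends only on the weight.
  have h1 : ∑ b : Fin n → ZMod 2 with hammingNorm b = hammingNorm a, cubeEigenvalue l b
      = (n.choose (hammingNorm a) : ℝ) * cubeEigenvalue l a := by
    rw [← card_hammingNorm_eq, ← nsmul_eq_mul]
    refine sum_eq_card_nsmul fun b hb => ?_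
    rw [cubeEigenvalue_eq_coeff, cubeEigenvalue_eq_coeff, (mem_filter.mp hb).2]
  have h2 : ∑ b : Fin n → ZMod 2 with hammingNorm b = hammingNorm a, cubeEigenvalue l b
      = ∑ v : Fin n → ZMod 2 with hammingNorm v = l, cubeEigenvalue (hammingNorm a) v := by
    simp only [cubeEigenvalue]
    rw [sum_comm]
    simp only [cubeChar_comm]
  rw [← h1, h2, ← card_hammingNorm_eq, ← nsmul_eq_mul]
  refine sum_eq_card_nsmul fun b hb => ?_
  rw [cubeEigenvalue_eq_coeff, (mem_filter.mp hb).2]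

/-! ### The least eigenvalue of `H_{4t-1,2t}` -/

/-- Equality holds at `m = y`. From `m = y + r` to `m + 1`, the right side grows by a factor
`(2m+3)/(2r+3) ≥ 1` more than the left. -/
theorem mul_choose_le_choose (y m : ℕ) (h : y ≤ m) :
    (2 * y + 1) * m.choose y ≤ (2 * m + 1).choose (2 * y) := by
  induction m, h using Nat.le_induction with
  | base => simp 
  | succ m hm ih =>
    obtain ⟨r, rfl⟩ := Nat.exists_eq_add_of_le hm
    have e1 : (y + r + 1).choose y * (r + 1) = (y + r + 1) * (y + r).choose y := by
      have := Nat.choose_mul_succ_eq (y + r) y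
      rw [show y + r + 1 - y = r + 1 by omega] at this
      linarith
    have e2 : (2 * (y + r) + 2).choose (2 * y) * (2 * r + 2)
        = (2 * (y + r) + 2) * (2 * (y + r) + 1).choose (2 * y) := by
      have := Nat.choose_mul_succ_eq (2 * (y + r) + 1) (2 * y)
      rw [show 2 * (y + r) + 1 + 1 - 2 * y = 2 * r + 2 by omega] at this
      linarith
    have e3 : (2 * (y + r) + 3).choose (2 * y) * (2 * r + 3)
        = (2 * (y + r) + 3) * (2 * (y + r) + 2).choose (2 * y) := by
      have := Nat.choose_mul_succ_eq (2 * (y + r) + 2) (2 * y)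
      rw [show 2 * (y + r) + 2 + 1 - 2 * y = 2 * r + 3 by omega] at this
      linarith
    rw [show 2 * (y + r + 1) + 1 = 2 * (y + r) + 3 by ring]
    refine Nat.le_of_mul_le_mul_right (c := (r + 1) * (2 * r + 3)) ?_ (by positivity)
    generalize (2 * (y + r) + 3).choose (2 * y) = A at *
    generalize (2 * (y + r) + 2).choose (2 * y) = B at *
    generalize (2 * (y + r) + 1).choose (2 * y) = D at *
    generalize (y + r + 1).choose y = E at *
    generalize (y + r).choose y = F at *
    have e2' : B * (r + 1) = (y + r + 1) * D := by nlinarith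
    calc (2 * y + 1) * E * ((r + 1) * (2 * r + 3))
        = (2 * y + 1) * (E * (r + 1)) * (2 * r + 3) := by ring
      _ = (y + r + 1) * (2 * r + 3) * ((2 * y + 1) * F) := by rw [e1]; ring
      _ ≤ (y + r + 1) * (2 * (y + r) + 3) * D :=
          Nat.mul_le_mul (Nat.mul_le_mul_left _ (by omega)) ih
      _ = (2 * (y + r) + 3) * (B * (r + 1)) := by rw [e2']; ring
      _ = A * (2 * r + 3) * (r + 1) := by rw [e3]; ring
      _ = A * ((r + 1) * (2 * r + 3)) := by ring

/-- The previous inequality at `(y - 1, m - 1)`, carried over by the absorption identity for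
binomials. -/
theorem mul_choose_le_choose_two_mul (y m : ℕ) (hy : 0 < y) (h : y ≤ m) :
    (2 * m + 1) * m.choose y ≤ (2 * m + 1).choose (2 * y) := by
  obtain ⟨z, rfl⟩ := Nat.exists_eq_succ_of_ne_zero hy.ne'
  obtain ⟨k, rfl⟩ := Nat.exists_eq_succ_of_ne_zero (show m ≠ 0 by omega)
  have ih := mul_choose_le_choose z k (by omega)
  have e1 := Nat.add_one_mul_choose_eq k z
  have e2 := Nat.add_one_mul_choose_eq (2 * k + 1) (2 * z)
  have e3 := Nat.add_one_mul_choose_eq (2 * k + 2) (2 * z + 1)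
  simp only [Nat.succ_eq_add_one] at *
  rw [show 2 * (k + 1) + 1 = 2 * k + 2 + 1 by ring, show 2 * (z + 1) = 2 * z + 1 + 1 by ring]
  rw [show 2 * k + 1 + 1 = 2 * k + 2 by ring] at e2
  generalize (2 * k + 2 + 1).choose (2 * z + 1 + 1) = A at *
  generalize (2 * k + 2).choose (2 * z + 1) = B at *
  generalize (2 * k + 1).choose (2 * z) = D at *
  generalize (k + 1).choose (z + 1) = E at *
  generalize k.choose z = F at *
  refine Nat.le_of_mul_le_mul_right (c := (z + 1) * (2 * z + 1)) ?_ (by positivity)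
  have e3' : (2 * k + 3) * B = 2 * (A * (z + 1)) := by nlinarith
  refine le_of_mul_le_mul_left (?_ : 2 * _ ≤ 2 * _) (Nat.succ_pos 1)
  calc 2 * ((2 * k + 2 + 1) * E * ((z + 1) * (2 * z + 1)))
      = 2 * (2 * k + 3) * (2 * z + 1) * (E * (z + 1)) := by ring
    _ = (2 * k + 3) * (2 * k + 2) * ((2 * z + 1) * F) := by rw [← e1]; ring
    _ ≤ (2 * k + 3) * (2 * k + 2) * D := Nat.mul_le_mul_left _ ih
    _ = (2 * k + 3) * B * (2 * z + 1) := by rw [mul_assoc, e2]; ring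
    _ = 2 * (A * ((z + 1) * (2 * z + 1))) := by rw [e3']; ring

open Polynomial in
theorem coeff_one_sub_X_sq_pow (m y : ℕ) :
    ((1 - X ^ 2) ^ m : ℝ[X]).coeff (2 * y) = (-1) ^ y * m.choose y ∧
    ((1 - X ^ 2) ^ m : ℝ[X]).coeff (2 * y + 1) = 0 := by
  have h : ((1 - X ^ 2) ^ m : ℝ[X]) = expand ℝ 2 (((1 + X) ^ m).comp (C (-1) * X)) := by
    simp [sub_eq_add_neg]
  rw [h]
  constructor
  · rw [mul_comm 2 y, coeff_expand_mul (by norm_num), comp_C_mul_X_coeff, coeff_one_add_X_pow, mul_comm]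
  · rw [coeff_expand (by norm_num), if_neg (by omega)]

open Polynomial in
theorem coeff_krawtchouk_middle (m y : ℕ) :
    ((1 - X) ^ (m + 1) * (1 + X) ^ m : ℝ[X]).coeff (2 * y) = (-1) ^ y * m.choose y ∧
    ((1 - X) ^ (m + 1) * (1 + X) ^ m : ℝ[X]).coeff (2 * y + 1) = -((-1) ^ y * m.choose y) := by
  have h : ((1 - X) ^ (m + 1) * (1 + X) ^ m : ℝ[X]) = (1 - X ^ 2) ^ m - X * (1 - X ^ 2) ^ m := by
    rw [show (1 - X ^ 2 : ℝ[X]) = (1 - X) * (1 + X) by ring, mul_pow]; ring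
  rw [h]
  constructor
  · rw [coeff_sub, (coeff_one_sub_X_sq_pow m y).1]
    cases y with
    | zero => simp
    | succ y =>
      rw [show 2 * (y + 1) = 2 * y + 1 + 1 by ring, coeff_X_mul, (coeff_one_sub_X_sq_pow m y).2,
        sub_zero]
  · rw [coeff_sub, (coeff_one_sub_X_sq_pow m y).2, coeff_X_mul, (coeff_one_sub_X_sq_pow m y).1,
      zero_sub]

open Polynomial in
theorem neg_choose_le_coeff (m x : ℕ) (hm : Odd m) (hx : x ≤ 2 * m + 1) :
    -((2 * m + 1).choose x : ℝ)
      ≤ (2 * m + 1) * ((1 - X) ^ (m + 1) * (1 + X) ^ m : ℝ[X]).coeff x := by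
  obtain ⟨y, rfl | rfl⟩ := Nat.even_or_odd' x
  · rw [(coeff_krawtchouk_middle m y).1]
    rcases Nat.even_or_odd y with hy | hy
    · rw [hy.neg_one_pow, one_mul]
      exact (neg_nonpos.mpr (by positivity)).trans (by positivity)
    · have := mul_choose_le_choose_two_mul y m hy.pos (by omega)
      have : ((2 * m + 1) * m.choose y : ℝ) ≤ (2 * m + 1).choose (2 * y) := by exact_mod_cast this
      rw [hy.neg_one_pow]
      linarith
  · rw [(coeff_krawtchouk_middle m y).2]
    rcases Nat.even_or_odd y with hy | hy
    -- Oddness of `m` excludes `y = m`, where the reflected index `m - y` would be zero and the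
    -- binomial inequality unavailable.
    · have hlt : y < m := lt_of_le_of_ne (by omega) fun e => by
        subst e; exact (Nat.not_even_iff_odd.mpr hm) hy
      have := mul_choose_le_choose_two_mul (m - y) m (by omega) (by omega)
      rw [Nat.choose_symm (by omega), Nat.choose_symm_of_eq_add
        (show 2 * m + 1 = 2 * (m - y) + (2 * y + 1) by omega)] at this
      have : ((2 * m + 1) * m.choose y : ℝ) ≤ (2 * m + 1).choose (2 * y + 1) := by
        exact_mod_cast this
      rw [hy.neg_one_pow]
      linarith
    · rw [hy.neg_one_pow, neg_one_mul, neg_neg]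
      exact (neg_nonpos.mpr (by positivity)).trans (by positivity)

theorem neg_le_mul_cubeEigenvalue {m : ℕ} (hm : Odd m) (a : Fin (2 * m + 1) → ZMod 2) :
    -(cubeEigenvalue (m + 1) (0 : Fin (2 * m + 1) → ZMod 2))
      ≤ (2 * m + 1) * cubeEigenvalue (m + 1) a := by
  have hx : hammingNorm a ≤ 2 * m + 1 := by simpa using hammingNorm_le_card_fintype (x := a)
  have h1 := choose_mul_cubeEigenvalue (m + 1) a
  rw [show 2 * m + 1 - (m + 1) = m by omega] at h1
  have h2 := neg_choose_le_coeff m _ hm hx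
  rw [cubeEigenvalue_zero, card_hammingNorm_eq]
  have h3 : (0 : ℝ) < (2 * m + 1).choose (hammingNorm a) := by exact_mod_cast Nat.choose_pos hx
  refine le_of_mul_le_mul_left ?_ h3
  have h4 := mul_le_mul_of_nonneg_left h2 (Nat.cast_nonneg (α := ℝ) ((2 * m + 1).choose (m + 1)))
  linear_combination h4 - (2 * m + 1) * h1

/-! ### The lower bound -/

/-- Only opposite signs matter: the negative factor takes its sharp bound, the other its absolute
bound, and `p ≤ q` covers negative `y`. -/
theorem neg_le_mul_mul {p q k l x y : ℝ} (hp : 0 < p) (hpq : p ≤ q) (hx : |x| ≤ k) (hy : |y| ≤ l)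
    (hxk : -k ≤ p * x) (hyl : -l ≤ q * y) : -(k * l) ≤ p * (x * y) := by
  have hk : 0 ≤ k := (abs_nonneg x).trans hx
  have hl : 0 ≤ l := (abs_nonneg y).trans hy
  obtain ⟨hx1, hx2⟩ := abs_le.mp hx
  obtain ⟨hy1, hy2⟩ := abs_le.mp hy
  rcases le_total 0 x with h0 | h0 <;> rcases le_total 0 y with h1 | h1
  · have : 0 ≤ p * (x * y) := by positivity
    nlinarith
  · have h : -l ≤ p * y := hyl.trans (mul_le_mul_of_nonpos_right hpq h1)
    nlinarith
  · nlinarith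
  · have : 0 ≤ x * y := mul_nonneg_of_nonpos_of_nonpos h0 h1
    have : 0 ≤ p * (x * y) := by positivity
    nlinarith

theorem le_of_hasQuantumHom {m r c : ℕ} (hm : Odd m) (hr : Odd r) (hmr : m ≤ r)
    (h : HasQuantumHom (graphProduct (hammingGraph (2 * m + 1) (m + 1))
      (hammingGraph (2 * r + 1) (r + 1))) (⊤ : SimpleGraph (Fin c))) :
    2 * m + 2 ≤ c := by
  classical
  set k := cubeEigenvalue (m + 1) (0 : Fin (2 * m + 1) → ZMod 2) with hk
  set l := cubeEigenvalue (r + 1) (0 : Fin (2 * r + 1) → ZMod 2) with hl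
  have hk0 : 0 < k := by
    rw [hk, cubeEigenvalue_zero, card_hammingNorm_eq]
    exact_mod_cast Nat.choose_pos (by omega)
  have hl0 : 0 < l := by
    rw [hl, cubeEigenvalue_zero, card_hammingNorm_eq]
    exact_mod_cast Nat.choose_pos (by omega)
  have hp : (0 : ℝ) < 2 * m + 1 := by positivity
  set N : ℝ := 2 ^ (2 * m + 1) * 2 ^ (2 * r + 1) with hN
  have hN0 : 0 < N := by positivity
  have hcard : (Fintype.card ((Fin (2 * m + 1) → ZMod 2) × (Fin (2 * r + 1) → ZMod 2)) : ℝ)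
      = N := by
    simp [hN, ZMod.card]
  set τ : ℝ := k * l / (2 * m + 1) with hτ
  have hτ0 : 0 < τ := by positivity
  let e : (Fin (2 * m + 1) → ZMod 2) × (Fin (2 * r + 1) → ZMod 2) →
      (Fin (2 * m + 1) → ZMod 2) × (Fin (2 * r + 1) → ZMod 2) → ℝ :=
    fun a v => cubeChar a.1 v.1 * cubeChar a.2 v.2
  -- Shifting by `τ` makes the spectrum nonnegative; the correction at `a = 0` cancels the top
  -- eigenvalue by subtracting a multiple of the all-ones matrix, which yields the constant `-δ` off
  -- the edges.
  let μ : (Fin (2 * m + 1) → ZMod 2) × (Fin (2 * r + 1) → ZMod 2) → ℝ := fun a =>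
    cubeEigenvalue (m + 1) a.1 * cubeEigenvalue (r + 1) a.2 + τ
      - if a = 0 then k * l + τ else 0
  have hμ : ∀ a, 0 ≤ μ a := by
    intro a
    simp only [μ]
    split_ifs with ha
    · subst ha; simp [hk, hl]
    · have := neg_le_mul_mul hp (show (2 * m + 1 : ℝ) ≤ 2 * r + 1 by
        have : (m : ℝ) ≤ r := by exact_mod_cast hmr
        linarith)
        (abs_cubeEigenvalue_le (m + 1) a.1) (abs_cubeEigenvalue_le (r + 1) a.2)
        (neg_le_mul_cubeEigenvalue hm a.1) (neg_le_mul_cubeEigenvalue hr a.2)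
      rw [← hk, ← hl] at this
      have h2 : τ * (2 * m + 1) = k * l := by rw [hτ]; field_simp
      rw [sub_zero]
      nlinarith
  have hone : ∀ {n : ℕ} (v w : Fin n → ZMod 2),
      ∑ a, cubeChar a v * cubeChar a w = if v = w then 2 ^ n else 0 := fun v w => by
    simp only [← cubeChar_add, sum_cubeChar, add_eq_zero_iff_eq_neg, cube_neg_eq]
  have hsum : ∀ v w, ∑ a, μ a * (e a v * e a w)
      = (if hammingDist v.1 w.1 = m + 1 ∧ hammingDist v.2 w.2 = r + 1 then N else 0)
        + (if v = w then τ * N else 0) - (k * l + τ) := by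
    intro v w
    have h1 : ∀ a, μ a * (e a v * e a w)
        = (cubeEigenvalue (m + 1) a.1 * (cubeChar a.1 v.1 * cubeChar a.1 w.1))
          * (cubeEigenvalue (r + 1) a.2 * (cubeChar a.2 v.2 * cubeChar a.2 w.2))
        + τ * ((cubeChar a.1 v.1 * cubeChar a.1 w.1) * (cubeChar a.2 v.2 * cubeChar a.2 w.2))
        - if a = 0 then k * l + τ else 0 := by
      intro a
      simp only [μ, e]
      split_ifs with ha
      · subst ha; simp only [Prod.fst_zero, Prod.snd_zero, cubeChar_zero_left]; ring
      · ring
    simp only [h1, sum_sub_distrib, sum_add_distrib, ← mul_sum, sum_ite_eq', mem_univ, if_true]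
    rw [Fintype.sum_prod_type, Fintype.sum_prod_type]
    simp only [← mul_sum, ← sum_mul, sum_cubeEigenvalue_mul, hone, Prod.ext_iff]
    congr 2
    · split_ifs <;> simp_all
    · split_ifs <;> simp_all
  have hb := h.hoffman e μ hμ (τ := τ * N) (δ := k * l + τ) (by positivity)
    (fun v => by rw [hsum]; simp) (fun v w hvw hadj => by
      rw [hsum, if_neg hvw, if_neg]
      · ring
      · rintro ⟨h1, h2⟩
        refine hadj ⟨⟨fun e => ?_, h1⟩, ⟨fun e => ?_, h2⟩⟩
        · rw [e, hammingDist_self] at h1; omega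
        · rw [e, hammingDist_self] at h2; omega)
  rw [hcard] at hb
  have h2 : τ * (2 * m + 1) = k * l := by rw [hτ]; field_simp
  have h3 : τ * N * (2 * m + 2) ≤ τ * N * c := by rw [← h2] at hb; linarith
  have := le_of_mul_le_mul_left h3 (by positivity)
  exact_mod_cast this

/-! ### The upper bound -/

theorem sum_root_of_unity {n : ℕ} {ζ : ℂ} (hζ : IsPrimitiveRoot ζ n) (i j : Fin n) :
    ∑ k : Fin n, star (ζ ^ (i * k : ℕ)) * ζ ^ (j * k : ℕ) = if i = j then (n : ℂ) else 0 := by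
  have hn : n ≠ 0 := fun h => (h ▸ i).elim0
  have hstar : star ζ = ζ⁻¹ := (Complex.inv_eq_conj (hζ.norm'_eq_one hn)).symm
  have hζ0 : ζ ≠ 0 := hζ.ne_zero hn
  have h1 : ∀ k : Fin n, star (ζ ^ (i * k : ℕ)) * ζ ^ (j * k : ℕ)
      = (ζ⁻¹ ^ (i : ℕ) * ζ ^ (j : ℕ)) ^ (k : ℕ) := fun k => by
    rw [star_pow, hstar, mul_pow, ← pow_mul, ← pow_mul]
  simp only [h1]
  rw [Fin.sum_univ_eq_sum_range (fun k => (ζ⁻¹ ^ (i : ℕ) * ζ ^ (j : ℕ)) ^ k) n]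
  split_ifs with h
  · subst h
    rw [← mul_pow, inv_mul_cancel₀ hζ0]
    simp
  · have hne : ζ⁻¹ ^ (i : ℕ) * ζ ^ (j : ℕ) ≠ 1 := fun e => h <| by
      rw [inv_pow, inv_mul_eq_one₀ (pow_ne_zero _ hζ0)] at e
      exact Fin.ext (hζ.pow_inj i.2 j.2 e)
    have h2 := mul_geom_sum (ζ⁻¹ ^ (i : ℕ) * ζ ^ (j : ℕ)) n
    have h3 : (ζ⁻¹ ^ (i : ℕ) * ζ ^ (j : ℕ)) ^ n = 1 := by
      rw [mul_pow, pow_right_comm, pow_right_comm ζ, inv_pow, hζ.pow_eq_one, inv_one, one_pow,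
        one_pow, one_mul]
    rw [h3, sub_self] at h2
    exact (mul_eq_zero.mp h2).resolve_left (sub_ne_zero.mpr hne)

theorem sum_signChar_mul {n : ℕ} (x y : Fin n → ZMod 2) :
    ∑ i, signChar (x i) * signChar (y i) = n - 2 * hammingDist x y := by
  have h : ∀ i, signChar (x i) * signChar (y i) = 1 - 2 * (if x i ≠ y i then 1 else 0) := fun i => by
    rw [signChar_mul]; by_cases h : x i = y i <;> simp [h]; norm_num
  simp only [h, sum_sub_distrib, ← mul_sum, hammingDist, card_filter]
  simp

/-- The vectors whose projections form the quantum colouring of `H_{2m,m}`. -/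
noncomputable def fourierVector {n : ℕ} (ζ : ℂ) (x : Fin n → ZMod 2) (j : Fin n) : Fin n → ℂ :=
  fun k => signChar (x k) * ζ ^ (j * k : ℕ)

theorem star_fourierVector_dotProduct {n : ℕ} (ζ : ℂ) (x y : Fin n → ZMod 2) (i j : Fin n) :
    star (fourierVector ζ x i) ⬝ᵥ fourierVector ζ y j
      = ∑ k : Fin n, ((signChar (x k) * signChar (y k) : ℝ) : ℂ) *
        (star (ζ ^ (i * k : ℕ)) * ζ ^ (j * k : ℕ)) := by
  refine sum_congr rfl fun k _ => ?_
  simp only [fourierVector, Pi.star_apply, star_mul', Complex.ofReal_mul]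
  rw [show star (signChar (x k) : ℂ) = signChar (x k) from Complex.conj_ofReal _]
  ring

theorem hammingGraph_hasQuantumHom {m : ℕ} (hm : 0 < m) :
    HasQuantumHom (hammingGraph (2 * m) m) (⊤ : SimpleGraph (Fin (2 * m))) := by
  have hn : 2 * m ≠ 0 := by omega
  have hζ := Complex.isPrimitiveRoot_exp (2 * m) hn
  set ζ := Complex.exp (2 * Real.pi * Complex.I / (2 * m : ℕ))
  have hζn : ‖ζ‖ = 1 := hζ.norm'_eq_one hn
  have hn' : ((2 * m : ℕ) : ℂ) ≠ 0 := by exact_mod_cast hn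
  set u := fourierVector (n := 2 * m) ζ
  have hself : ∀ x i j, star (u x i) ⬝ᵥ u x j = if i = j then ((2 * m : ℕ) : ℂ) else 0 := by
    intro x i j
    rw [star_fourierVector_dotProduct, ← sum_root_of_unity hζ]
    simp [signChar_mul_self]
  have hmul : ∀ x y i j,
      (((2 * m : ℕ) : ℂ)⁻¹ • vecMulVec (u x i) (star (u x i))) *
        (((2 * m : ℕ) : ℂ)⁻¹ • vecMulVec (u y j) (star (u y j)))
      = (((2 * m : ℕ) : ℂ)⁻¹ * ((2 * m : ℕ) : ℂ)⁻¹ * (star (u x i) ⬝ᵥ u y j)) •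
        vecMulVec (u x i) (star (u y j)) := by
    intro x y i j
    rw [Matrix.smul_mul, Matrix.mul_smul, vecMulVec_mul_vecMulVec, smul_smul, vecMulVec_smul,
      smul_smul]
  refine ⟨2 * m, by omega, fun x j => ((2 * m : ℕ) : ℂ)⁻¹ • vecMulVec (u x j) (star (u x j)),
    ?_, ?_, ?_, ?_, ?_⟩
  · intro x j
    rw [hmul, hself, if_pos rfl, mul_assoc, inv_mul_cancel₀ hn', mul_one]
  · intro x j
    rw [conjTranspose_smul, conjTranspose_vecMulVec]
    simp
  · intro x i j hij
    rw [hmul, hself, if_neg hij, mul_zero, zero_smul]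
  · intro x
    ext k l
    have h1 := sum_root_of_unity hζ l k
    have h2 : ∀ j : Fin (2 * m), u x j k * star (u x j l) = (signChar (x k) * signChar (x l) : ℂ) *
        (star (ζ ^ (l * j : ℕ)) * ζ ^ (k * j : ℕ)) := fun j => by
      simp only [u, fourierVector, star_mul']
      rw [show star (signChar (x l) : ℂ) = signChar (x l) from Complex.conj_ofReal _,
        mul_comm (j : ℕ), mul_comm (j : ℕ)]
      ring
    rw [Matrix.sum_apply]
    simp only [Matrix.smul_apply, vecMulVec_apply, Pi.star_apply, h2, smul_eq_mul, ← mul_sum, h1]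
    rcases eq_or_ne k l with rfl | hkl
    · rw [if_pos rfl, Matrix.one_apply_eq, ← Complex.ofReal_mul, signChar_mul_self]
      rw [Complex.ofReal_one, one_mul, inv_mul_cancel₀ hn']
    · rw [if_neg hkl.symm, Matrix.one_apply_ne hkl]; simp
  · intro x y i j hxy hij
    obtain rfl : i = j := by simpa using hij
    -- With equal colours the Fourier phases cancel, leaving the sign inner product `2m - 2·m = 0`.
    have hdot : star (u x i) ⬝ᵥ u y i = 0 := by
      rw [star_fourierVector_dotProduct]
      have h1 : ∀ k : ℕ, star (ζ ^ k) * ζ ^ k = 1 := fun k => by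
        rw [star_pow, ← mul_pow, show star ζ = ζ⁻¹ from (Complex.inv_eq_conj hζn).symm,
          inv_mul_cancel₀ (hζ.ne_zero hn), one_pow]
      simp only [h1, mul_one]
      rw [← Complex.ofReal_sum, sum_signChar_mul, hxy.2]
      simp
    rw [hmul, hdot, mul_zero, zero_smul]

end QuantumColoring

open QuantumColoring in
theorem theorem3p11 (s t : ℕ) (ht : 0 < t) (hst : t ≤ s) :
    quantumChromaticNumber
        (graphProduct (hammingGraph (4 * t) (2 * t)) (hammingGraph (4 * s) (2 * s)))
      = ((4 * t : ℕ) : ℕ∞) ∧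
    quantumChromaticNumber
        (graphProduct (hammingGraph (4 * t - 1) (2 * t)) (hammingGraph (4 * s) (2 * s)))
      = ((4 * t : ℕ) : ℕ∞) ∧
    quantumChromaticNumber
        (graphProduct (hammingGraph (4 * t) (2 * t)) (hammingGraph (4 * s - 1) (2 * s)))
      = ((4 * t : ℕ) : ℕ∞) ∧
    quantumChromaticNumber
        (graphProduct (hammingGraph (4 * t - 1) (2 * t)) (hammingGraph (4 * s - 1) (2 * s)))
      = ((4 * t : ℕ) : ℕ∞) := by
  have succHom : ∀ r, 0 < r →
      Nonempty (hammingGraph (4 * r - 1) (2 * r) →g hammingGraph (4 * r) (2 * r)) := fun r hr => by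
    have := hammingGraphSucc (4 * r - 1) (2 * r)
    rw [show 4 * r - 1 + 1 = 4 * r by omega] at this
    exact ⟨this⟩
  obtain ⟨f⟩ := succHom t ht
  obtain ⟨g⟩ := succHom s (by omega)
  have upper : HasQuantumHom (hammingGraph (4 * t) (2 * t)) (⊤ : SimpleGraph (Fin (4 * t))) := by
    have := hammingGraph_hasQuantumHom (m := 2 * t) (by omega)
    rwa [show 2 * (2 * t) = 4 * t by ring] at this
  have lower : ∀ c, HasQuantumHom (graphProduct (hammingGraph (4 * t - 1) (2 * t))
      (hammingGraph (4 * s - 1) (2 * s))) (⊤ : SimpleGraph (Fin c)) → 4 * t ≤ c := fun c h => by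
    have key := le_of_hasQuantumHom (m := 2 * t - 1) (r := 2 * s - 1) (c := c)
      ⟨t - 1, by omega⟩ ⟨s - 1, by omega⟩ (by omega)
    rw [show 2 * (2 * t - 1) + 1 = 4 * t - 1 by omega, show 2 * t - 1 + 1 = 2 * t by omega,
      show 2 * (2 * s - 1) + 1 = 4 * s - 1 by omega, show 2 * s - 1 + 1 = 2 * s by omega] at key
    have := key h
    omega
  refine ⟨quantumChromaticNumber_eq (upper.comp (graphProductFst _ _))
      fun c h => lower c (h.comp (graphProductMap f g)),
    quantumChromaticNumber_eq (upper.comp (f.comp (graphProductFst _ _)))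
      fun c h => lower c (h.comp (graphProductMap .id g)),
    quantumChromaticNumber_eq (upper.comp (graphProductFst _ _))
      fun c h => lower c (h.comp (graphProductMap f .id)),
    quantumChromaticNumber_eq (upper.comp (f.comp (graphProductFst _ _))) lower⟩
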